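/- Let $N, n_B$ be natural numbers and let $\mathbf H\in\mathbb C^{n_B\times 2N}$ be a random matrix with i.i.d. complex entries, each having independent real and imaginary parts $\sim\mathcal N(0,1/2)$. Let $\mathbf H=\mathbf U\boldsymbol\Lambda\mathbf V^H$ be a (full) singular value decomposition, with $\mathbf U\in\mathbb C^{n_B\times n_B}$ and $\mathbf V\in\mathbb C^{2N\times 2N}$ unitary and $\boldsymbol\Lambda$ an $n_B\times 2N$ diagonal matrix with real diagonal entries $\lambda_0\ge\lambda_1\ge\cdots\ge 0$, and let $\underline{\boldsymbol\lambda}=(\lambda_0,\dots,\lambda_{2N-1})^T$ be the vector of ordered singular values, with $\lambda_l=0$ for $l\ge n_B$. Since $\mathbf V$ is not determined by $\mathbf H$, it is chosen uniformly: conditionally on $\mathbf H$, $\mathbf V$ is uniformly distributed over the set of all right unitary factors of singular value decompositions of $\mathbf H$ (i.e. its conditional law is the unique probability measure on this set that is invariant under $\mathbf V\mapsto\mathbf Q\mathbf V$ for all unitary $\mathbf Q$ commuting with $\mathbf H^H\mathbf H$). Let $\mathbf P$ be a uniformly random $2N\times 2N$ permutation matrix, independent of $(\mathbf H,\mathbf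 V)$, and put $\mathbf W=\mathbf V\mathbf P$. Then, for almost every value of $(\mathbf W,\underline{\boldsymbol\lambda})$ and for any two $2N\times 2N$ permutation matrices $\mathbf p,\mathbf p'$, $$\Pr(\mathbf P=\mathbf p\mid\mathbf W,\underline{\boldsymbol\lambda})=\Pr(\mathbf P=\mathbf p'\mid\mathbf W,\underline{\boldsymbol\lambda})=\frac1{(2N)!}.$$ Consequently the permutation $\pi$ induced by $\mathbf P^T$, i.e. $\mathbf P^T x=(x_{\pi(0)},\dots,x_{\pi(2N-1)})^T$ for all $x\in\mathbb C^{2N}$, which says that subchannel $l$ carries the gain $\lambda_{\pi(l)}$, is also conditionally uniform: $\Pr(\pi=\tau\mid\mathbf W,\underline{\boldsymbol\lambda})=\frac1{(2N)!}$ almost surely, for every permutation $\tau$ of $\{0,\dots,2N-1\}$. -/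

import Mathlib

open MeasureTheory ProbabilityTheory Matrix
open scoped ENNReal NNReal Nat

/-- The product sigma-algebra on matrices. For complex matrices this is the Borel one. -/
instance Matrix.instMeasurableSpacePi {m n α : Type*} [MeasurableSpace α] :
    MeasurableSpace (Matrix m n α) :=
  inferInstanceAs (MeasurableSpace (m → n → α))

instance Matrix.instStandardBorelSpacePi {m n α : Type*} [Countable m] [Countable n]
    [MeasurableSpace α] [StandardBorelSpace α] : StandardBorelSpace (Matrix m n α) :=
  inferInstanceAs (StandardBorelSpace (m → n → α))

/-- The entries of the random matrix `H` are i.i.d. circularly symmetric complex Gaussian: they are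
independent, and each has independent real and imaginary parts of law `N(0, 1/2)`. -/
structure IsIIDComplexGaussian {Ω : Type*} [MeasurableSpace Ω] {b a : ℕ}
    (H : Ω → Matrix (Fin b) (Fin a) ℂ) (μ : Measure Ω) : Prop where
  measurable : Measurable H
  iIndep_entries :
    iIndepFun (fun (p : Fin b × Fin a) (ω : Ω) => H ω p.1 p.2) μ
  indep_re_im : ∀ i j, IndepFun (fun ω => (H ω i j).re) (fun ω => (H ω i j).im) μ
  law_re : ∀ i j, HasLaw (fun ω => (H ω i j).re) (gaussianReal 0 (1 / 2)) μ
  law_im : ∀ i j, HasLaw (fun ω => (H ω i j).im) (gaussianReal 0 (1 / 2)) μ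

/-- The `b × a` matrix with `s 0, s 1, …` on its main diagonal and zeros elsewhere. -/
def rectDiagonal (b : ℕ) {a : ℕ} (s : Fin a → ℝ) : Matrix (Fin b) (Fin a) ℂ :=
  Matrix.of fun i j => if (i : ℕ) = (j : ℕ) then (s j : ℂ) else 0

/-- `h = U Λ Vᴴ` is a (full) singular value decomposition of the `b × a` matrix `h`; the vector `s`
of length `a` holds the singular values on the diagonal of `Λ` in non-increasing order, padded
by zeros when `b < a`. -/
structure IsSVD {b a : ℕ} (h : Matrix (Fin b) (Fin a) ℂ) (U : Matrix (Fin b) (Fin b) ℂ)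
    (s : Fin a → ℝ) (V : Matrix (Fin a) (Fin a) ℂ) : Prop where
  left_unitary : U ∈ Matrix.unitaryGroup (Fin b) ℂ
  right_unitary : V ∈ Matrix.unitaryGroup (Fin a) ℂ
  nonneg : ∀ l, 0 ≤ s l
  antitone : Antitone s
  zero_padded : ∀ l : Fin a, b ≤ (l : ℕ) → s l = 0
  eq_mul : h = U * rectDiagonal b s * Vᴴ

/-- `V` is the right unitary factor of some singular value decomposition of `h`. -/
def IsRightSingularFactor {b a : ℕ} (h : Matrix (Fin b) (Fin a) ℂ)
    (V : Matrix (Fin a) (Fin a) ℂ) : Prop :=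
  ∃ U s, IsSVD h U s V

/-- `ν` is the uniform probability distribution on the compact set of right singular factors
of `h`. The compact group of the unitary `Q` that commute with `hᴴ h` acts simply transitively
on this set by left multiplication; the uniform distribution is the unique
probability measure on the set that is invariant under this action. -/
structure IsUniformOnRightSingularFactors {b a : ℕ} (h : Matrix (Fin b) (Fin a) ℂ)
    (ν : Measure (Matrix (Fin a) (Fin a) ℂ)) : Prop where
  isProbability : IsProbabilityMeasure ν
  ae_mem : ∀ᵐ V ∂ν, IsRightSingularFactor h V
  map_mul_left : ∀ Q ∈ Matrix.unitaryGroup (Fin a) ℂ, Commute Q (hᴴ * h) →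
    ν.map (fun V => Q * V) = ν

/-- The random matrix `P` is a uniformly distributed `a × a` permutation matrix. -/
structure IsUniformPermMatrix {Ω : Type*} [MeasurableSpace Ω] {a : ℕ}
    (P : Ω → Matrix (Fin a) (Fin a) ℂ) (μ : Measure Ω) : Prop where
  measurable : Measurable P
  prob_eq : ∀ σ : Equiv.Perm (Fin a), μ {ω | P ω = σ.permMatrix ℂ} = ((a ! : ℕ) : ℝ≥0∞)⁻¹

/-!
Revealing `W = V P` and the singular values says nothing about `P`, because the law of `V` given the
singular values is the Haar measure of the unitary group, which is also invariant under `V ↦ V σ`.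

Left invariance comes from the Gaussian law: the characteristic function of `H` is radial, so `H Qᴴ`
has the law of `H` for each unitary `Q` (`IsIIDComplexGaussian.map_mul_unitary`). If `h` has right
singular factor `V`, then `h Qᴴ` has right singular factor `Q V` and the same singular values. The
uniform distribution on right singular factors is unique, hence equivariant
(`IsUniformOnRightSingularFactors.unique`, `IsUniformOnRightSingularFactors.mul_unitary`), and so
`(H Qᴴ, Q V)` has the law of `(H, V)` (`map_prodMk_mul_unitary`). Hence `(Q V, λ)` has the law of
`(V, λ)`.

Right invariance follows from left invariance since a left-invariant finite measure on a group of
unitary matrices is determined by its mass (`measure_eq_of_map_mul_left`). This is proved by Fubini,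
and the same lemma gives the uniqueness of the uniform distribution on right singular factors.

As `P` is independent of `(V, λ)`, the event `{P = σ, (V P, λ) ∈ B}` has probability
`ℙ((V σ, λ) ∈ B) / (2N)! = ℙ((V, λ) ∈ B) / (2N)!`, which does not depend on `σ`
(`IsUniformPermMatrix.condExp_eq`).
-/

/-! ### Measurability of matrix operations -/

theorem Measurable.matrix_mul {Ω l m n : Type*} [MeasurableSpace Ω] [Fintype m]
    {f : Ω → Matrix l m ℂ} {g : Ω → Matrix m n ℂ} (hf : Measurable f) (hg : Measurable g) :
    Measurable fun ω => f ω * g ω := by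
  refine measurable_pi_lambda _ fun i => measurable_pi_lambda _ fun j => ?_
  simp only [Matrix.mul_apply]
  exact Finset.measurable_sum _ fun k _ =>
    ((measurable_pi_apply k).comp ((measurable_pi_apply i).comp hf)).mul
      ((measurable_pi_apply j).comp ((measurable_pi_apply k).comp hg))

theorem Measurable.matrix_conjTranspose {Ω m n : Type*} [MeasurableSpace Ω]
    {f : Ω → Matrix m n ℂ} (hf : Measurable f) : Measurable fun ω => (f ω)ᴴ := by
  refine measurable_pi_lambda _ fun i => measurable_pi_lambda _ fun j => ?_
  exact Complex.continuous_conj.measurable.comp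
    ((measurable_pi_apply i).comp ((measurable_pi_apply j).comp hf))

theorem measurable_matrix_mul_left {m n : Type*} [Fintype m] (Q : Matrix m m ℂ) :
    Measurable fun V : Matrix m n ℂ => Q * V :=
  measurable_const.matrix_mul measurable_id

theorem measurable_matrix_mul_right {m n : Type*} [Fintype n] (Q : Matrix n n ℂ) :
    Measurable fun V : Matrix m n ℂ => V * Q :=
  measurable_id.matrix_mul measurable_const

/-- An almost sure property can be transported along a measurable bijection even when it is not
known to be measurable, as for membership in the set of right singular factors. -/
theorem ae_map_of_leftInverse {α β : Type*} [MeasurableSpace α] [MeasurableSpace β]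
    {μ : Measure α} {f : α → β} {g : β → α} (hf : Measurable f) (hg : Measurable g)
    (hgf : Function.LeftInverse g f) (hfg : Function.RightInverse g f) {p : β → Prop}
    (h : ∀ᵐ x ∂μ, p (f x)) : ∀ᵐ y ∂(μ.map f), p y :=
  (MeasurableEquiv.measurableEmbedding ⟨⟨f, g, hgf, hfg⟩, hf, hg⟩).ae_map_iff.2 h

/-! ### Uniqueness of left-invariant measures -/

/-- Fubini for the set `{(A, B) | Bᴴ A ∈ C}`. For fixed `B` the law of `Bᴴ A` is that of `A`; for
fixed `A` the law of `Bᴴ A = (Aᴴ B)ᴴ` is that of `Bᴴ`. -/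
theorem measure_mul_conjTranspose_preimage_of_map_mul_left {n : Type*} [Fintype n]
    {S : Set (Matrix n n ℂ)} (hS : ∀ Q ∈ S, Qᴴ ∈ S) {ν₁ ν₂ : Measure (Matrix n n ℂ)}
    [IsFiniteMeasure ν₁] [IsFiniteMeasure ν₂]
    (h₁ : ∀ᵐ V ∂ν₁, V ∈ S) (h₂ : ∀ᵐ V ∂ν₂, V ∈ S)
    (inv₁ : ∀ Q ∈ S, ν₁.map (fun V => Q * V) = ν₁) (inv₂ : ∀ Q ∈ S, ν₂.map (fun V => Q * V) = ν₂)
    {C : Set (Matrix n n ℂ)} (hC : MeasurableSet C) :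
    ν₁ C * ν₂ Set.univ = ν₂ ((fun V => Vᴴ) ⁻¹' C) * ν₁ Set.univ := by
  let T : Set (Matrix n n ℂ × Matrix n n ℂ) := (fun p => p.2ᴴ * p.1) ⁻¹' C
  have hT : MeasurableSet T :=
    (measurable_snd.matrix_conjTranspose.matrix_mul measurable_fst) hC
  have e₁ : (ν₁.prod ν₂) T = ν₁ C * ν₂ Set.univ := by
    rw [Measure.prod_apply_symm hT, ← lintegral_const]
    refine lintegral_congr_ae (h₂.mono fun B hB => ?_)
    change _ = ν₁ C
    rw [← inv₁ _ (hS B hB), Measure.map_apply (measurable_matrix_mul_left _) hC,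
      inv₁ _ (hS B hB)]
    rfl
  have e₂ : (ν₁.prod ν₂) T = ν₂ ((fun V => Vᴴ) ⁻¹' C) * ν₁ Set.univ := by
    rw [Measure.prod_apply hT, ← lintegral_const]
    refine lintegral_congr_ae (h₁.mono fun A hA => ?_)
    change _ = ν₂ ((fun V => Vᴴ) ⁻¹' C)
    have hC' : MeasurableSet ((fun V : Matrix n n ℂ => Vᴴ) ⁻¹' C) :=
      measurable_id.matrix_conjTranspose hC
    rw [← inv₂ _ (hS A hA), Measure.map_apply (measurable_matrix_mul_left _) hC',
      inv₂ _ (hS A hA)]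
    refine congrArg ν₂ (Set.ext fun B => ?_)
    simp [T]
  rw [← e₁, e₂]

/-- Uniqueness of a left-invariant finite measure of given mass. It is enough that `S` is closed
under conjugate transposition; in the applications `S` is a group of unitary matrices. -/
theorem measure_eq_of_map_mul_left {n : Type*} [Fintype n]
    {S : Set (Matrix n n ℂ)} (hS : ∀ Q ∈ S, Qᴴ ∈ S) {ν₁ ν₂ : Measure (Matrix n n ℂ)}
    [IsFiniteMeasure ν₁] (hmass : ν₁ Set.univ = ν₂ Set.univ)
    (h₁ : ∀ᵐ V ∂ν₁, V ∈ S) (h₂ : ∀ᵐ V ∂ν₂, V ∈ S)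
    (inv₁ : ∀ Q ∈ S, ν₁.map (fun V => Q * V) = ν₁)
    (inv₂ : ∀ Q ∈ S, ν₂.map (fun V => Q * V) = ν₂) : ν₁ = ν₂ := by
  have : IsFiniteMeasure ν₂ := ⟨hmass ▸ measure_lt_top ν₁ _⟩
  by_cases h0 : ν₂ Set.univ = 0
  · rw [Measure.measure_univ_eq_zero.1 h0, Measure.measure_univ_eq_zero.1 (hmass.trans h0)]
  ext C hC
  -- `ν₁` and `ν₂` both agree with the image of `ν₂` under `V ↦ Vᴴ`.
  have k₁ := measure_mul_conjTranspose_preimage_of_map_mul_left hS h₁ h₂ inv₁ inv₂ hC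
  have k₂ := measure_mul_conjTranspose_preimage_of_map_mul_left hS h₂ h₂ inv₂ inv₂ hC
  rw [hmass, ← k₂] at k₁
  exact (ENNReal.mul_left_inj h0 (measure_ne_top _ _)).1 k₁

/-! ### Uniqueness of singular values and of the uniform right singular factor -/

theorem Antitone.eq_of_multiset_map_eq {a : ℕ} {d d' : Fin a → ℝ} (hd : Antitone d)
    (hd' : Antitone d')
    (h : Multiset.map d Finset.univ.val = Multiset.map d' Finset.univ.val) : d = d' := by
  rw [Fin.univ_val_map, Fin.univ_val_map, Multiset.coe_eq_coe] at h
  exact List.ofFn_injective (h.eq_of_pairwise' (r := (· ≥ ·)) hd.sortedGE_ofFn.pairwise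
    hd'.sortedGE_ofFn.pairwise)

theorem rectDiagonal_conjTranspose_mul_self {b a : ℕ} {s : Fin a → ℝ}
    (hz : ∀ l : Fin a, b ≤ (l : ℕ) → s l = 0) :
    (rectDiagonal b s)ᴴ * rectDiagonal b s = diagonal fun l => ((s l ^ 2 : ℝ) : ℂ) := by
  ext i j
  rw [Matrix.mul_apply, diagonal_apply]
  simp only [rectDiagonal, conjTranspose_apply, of_apply]
  -- Column `i` of `Λ` vanishes when `b ≤ i`; there the identity relies on the zero padding of `s`.
  by_cases hi : (i : ℕ) < b
  · rw [Finset.sum_eq_single ⟨i, hi⟩]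
    · by_cases hij : i = j
      · subst hij; simp [sq]
      · have : (i : ℕ) ≠ j := fun e => hij (Fin.ext e)
        simp [hij, this]
    · intro k _ hk
      have : (k : ℕ) ≠ i := fun e => hk (Fin.ext e)
      simp [this]
    · simp
  · rw [Finset.sum_eq_zero]
    · simp [hz i (not_lt.1 hi)]
    · intro k _
      have : (k : ℕ) ≠ i := fun e => hi (e ▸ k.2)
      simp [this]

namespace IsSVD
variable {b a : ℕ} {h : Matrix (Fin b) (Fin a) ℂ} {U : Matrix (Fin b) (Fin b) ℂ}
  {s : Fin a → ℝ} {V : Matrix (Fin a) (Fin a) ℂ}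

theorem conjTranspose_mul_self_eq (H : IsSVD h U s V) :
    hᴴ * h = V * (diagonal fun l => ((s l ^ 2 : ℝ) : ℂ)) * Vᴴ := by
  have hU : Uᴴ * U = 1 := (mem_unitaryGroup_iff'.1 H.left_unitary)
  rw [← rectDiagonal_conjTranspose_mul_self H.zero_padded, H.eq_mul]
  simp only [conjTranspose_mul, conjTranspose_conjTranspose, Matrix.mul_assoc]
  rw [← Matrix.mul_assoc Uᴴ, hU, Matrix.one_mul]

theorem conj_right_eq_diagonal (H : IsSVD h U s V) :
    Vᴴ * (hᴴ * h) * V = diagonal fun l => ((s l ^ 2 : ℝ) : ℂ) := by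
  have hV : Vᴴ * V = 1 := (mem_unitaryGroup_iff'.1 H.right_unitary)
  rw [H.conjTranspose_mul_self_eq]
  simp only [Matrix.mul_assoc]
  rw [hV, Matrix.mul_one, ← Matrix.mul_assoc, hV, Matrix.one_mul]

/-- The squared singular values are the roots of the characteristic polynomial of `hᴴ h`, and their
order is fixed by monotonicity. -/
theorem singularValues_unique {U' : Matrix (Fin b) (Fin b) ℂ}
    {s' : Fin a → ℝ} {V' : Matrix (Fin a) (Fin a) ℂ} (H : IsSVD h U s V) (H' : IsSVD h U' s' V') :
    s = s' := by
  have key : ∀ {U : Matrix (Fin b) (Fin b) ℂ} {s : Fin a → ℝ} {V : Matrix (Fin a) (Fin a) ℂ},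
      IsSVD h U s V → (hᴴ * h).charpoly.roots =
        Multiset.map (fun l => ((s l ^ 2 : ℝ) : ℂ)) Finset.univ.val := by
    intro U s V H
    have hV : Vᴴ * V = 1 := (mem_unitaryGroup_iff'.1 H.right_unitary)
    rw [H.conjTranspose_mul_self_eq, charpoly_mul_comm, ← Matrix.mul_assoc, hV, Matrix.one_mul,
      charpoly_diagonal]
    rw [Finset.prod_eq_multiset_prod, ← Polynomial.roots_multiset_prod_X_sub_C
      (Multiset.map (fun l => ((s l ^ 2 : ℝ) : ℂ)) Finset.univ.val), Multiset.map_map]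
    rfl
  have h1 := (key H).symm.trans (key H')
  refine H.antitone.eq_of_multiset_map_eq H'.antitone ?_
  have h2 := congrArg (Multiset.map fun z : ℂ => √z.re) h1
  simpa only [Multiset.map_map, Function.comp_def, Complex.ofReal_re, Real.sqrt_sq (H.nonneg _),
    Real.sqrt_sq (H'.nonneg _)] using h2

theorem singularValue_eq_sqrt (H : IsSVD h U s V) (l : Fin a) :
    s l = √((Vᴴ * (hᴴ * h) * V) l l).re := by
  rw [H.conj_right_eq_diagonal, diagonal_apply_eq, Complex.ofReal_re, Real.sqrt_sq (H.nonneg l)]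

theorem mul_unitary (H : IsSVD h U s V) {Q : Matrix (Fin a) (Fin a) ℂ}
    (hQ : Q ∈ unitaryGroup (Fin a) ℂ) : IsSVD (h * Qᴴ) U s (Q * V) where
  left_unitary := H.left_unitary
  right_unitary := mul_mem hQ H.right_unitary
  nonneg := H.nonneg
  antitone := H.antitone
  zero_padded := H.zero_padded
  eq_mul := by rw [H.eq_mul, conjTranspose_mul]; simp only [Matrix.mul_assoc]

end IsSVD

/-- Transitivity: any two right singular factors of `h` differ by left multiplication by a unitary
matrix that commutes with `hᴴ h`. -/
theorem IsRightSingularFactor.commute_mul_conjTranspose {b a : ℕ} {h : Matrix (Fin b) (Fin a) ℂ}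
    {V V' : Matrix (Fin a) (Fin a) ℂ}
    (H : IsRightSingularFactor h V) (H' : IsRightSingularFactor h V') :
    Commute (V' * Vᴴ) (hᴴ * h) := by
  obtain ⟨U, s, H⟩ := H
  obtain ⟨U', s', H'⟩ := H'
  obtain rfl := H.singularValues_unique H'
  have hV : Vᴴ * V = 1 := mem_unitaryGroup_iff'.1 H.right_unitary
  have hV' : V'ᴴ * V' = 1 := mem_unitaryGroup_iff'.1 H'.right_unitary
  set D : Matrix (Fin a) (Fin a) ℂ := diagonal fun l => ((s l ^ 2 : ℝ) : ℂ)
  calc V' * Vᴴ * (hᴴ * h) = V' * (Vᴴ * V) * D * Vᴴ := by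
        rw [H.conjTranspose_mul_self_eq]; simp only [D, Matrix.mul_assoc]
    _ = V' * D * (V'ᴴ * V') * Vᴴ := by rw [hV, hV']; simp
    _ = hᴴ * h * (V' * Vᴴ) := by
        rw [H'.conjTranspose_mul_self_eq]; simp only [D, Matrix.mul_assoc]

namespace IsUniformOnRightSingularFactors
variable {b a : ℕ} {h : Matrix (Fin b) (Fin a) ℂ} {ν ν' : Measure (Matrix (Fin a) (Fin a) ℂ)}

/-- There is only one uniform distribution on the right singular factors of `h`. Right multiplication
by `V₀ᴴ`, for any fixed factor `V₀`, carries it to a left-invariant probability measure on the group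
of unitaries commuting with `hᴴ h`, where such a measure is unique. -/
theorem unique (H : IsUniformOnRightSingularFactors h ν)
    (H' : IsUniformOnRightSingularFactors h ν') : ν = ν' := by
  have := H.isProbability
  have := H'.isProbability
  obtain ⟨V₀, hV₀⟩ := H.ae_mem.exists
  have hu : V₀ ∈ unitaryGroup (Fin a) ℂ := hV₀.elim fun _ ⟨_, k⟩ => k.right_unitary
  have hV₁ : V₀ᴴ * V₀ = 1 := mem_unitaryGroup_iff'.1 hu
  have hV₂ : V₀ * V₀ᴴ = 1 := mem_unitaryGroup_iff.1 hu
  have hm := measurable_matrix_mul_right (m := Fin a) V₀ᴴ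
  let S : Set (Matrix (Fin a) (Fin a) ℂ) := {Q | Q ∈ unitaryGroup (Fin a) ℂ ∧ Commute Q (hᴴ * h)}
  have hS : ∀ Q ∈ S, Qᴴ ∈ S := fun Q hQ => ⟨Unitary.star_mem hQ.1, by
    simpa [Commute, SemiconjBy, eq_comm] using congrArg conjTranspose hQ.2.eq⟩
  have hprob : ∀ {ν}, IsUniformOnRightSingularFactors h ν →
      ν.map (fun V => V * V₀ᴴ) Set.univ = 1 := fun {ν} k => by
    have := k.isProbability
    rw [Measure.map_apply hm .univ]; simp
  have hmem : ∀ {ν}, IsUniformOnRightSingularFactors h ν →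
      ∀ᵐ V ∂(ν.map fun V => V * V₀ᴴ), V ∈ S := fun {ν} k => by
    refine ae_map_of_leftInverse hm (measurable_matrix_mul_right V₀)
      (fun V => by simp [Matrix.mul_assoc, hV₁]) (fun V => by simp [Matrix.mul_assoc, hV₂]) ?_
    filter_upwards [k.ae_mem] with V hV
    exact ⟨mul_mem (hV.elim fun _ ⟨_, k⟩ => k.right_unitary) (Unitary.star_mem hu),
      hV₀.commute_mul_conjTranspose hV⟩
  have hinv : ∀ {ν}, IsUniformOnRightSingularFactors h ν → ∀ Q ∈ S,
      (ν.map fun V => V * V₀ᴴ).map (fun V => Q * V) = ν.map fun V => V * V₀ᴴ := fun {ν} k Q hQ => by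
    have hl := measurable_matrix_mul_left (n := Fin a) Q
    conv_rhs => rw [← k.map_mul_left Q hQ.1 hQ.2, Measure.map_map hm hl]
    rw [Measure.map_map hl hm]
    simp only [Function.comp_def, Matrix.mul_assoc]
  have heq := measure_eq_of_map_mul_left hS ((hprob H).trans (hprob H').symm) (hmem H) (hmem H')
    (hinv H) (hinv H')
  have hback : ∀ ν : Measure (Matrix (Fin a) (Fin a) ℂ),
      (ν.map fun V => V * V₀ᴴ).map (fun V => V * V₀) = ν := fun ν => by
    rw [Measure.map_map (measurable_matrix_mul_right V₀) hm]
    simp [Function.comp_def, Matrix.mul_assoc, hV₁]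
  rw [← hback ν, heq, hback]

/-- Equivariance: `V ↦ Q V` carries the uniform distribution for `h` to the one for `h Qᴴ`. -/
theorem mul_unitary (H : IsUniformOnRightSingularFactors h ν) {Q : Matrix (Fin a) (Fin a) ℂ}
    (hQ : Q ∈ unitaryGroup (Fin a) ℂ) :
    IsUniformOnRightSingularFactors (h * Qᴴ) (ν.map fun V => Q * V) := by
  have hl := measurable_matrix_mul_left (m := Fin a) (n := Fin a)
  have hQ1 : Qᴴ * Q = 1 := mem_unitaryGroup_iff'.1 hQ
  have hQ2 : Q * Qᴴ = 1 := mem_unitaryGroup_iff.1 hQ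
  have := H.isProbability
  refine ⟨Measure.isProbabilityMeasure_map (hl Q).aemeasurable, ?_, fun R hR hc => ?_⟩
  · refine ae_map_of_leftInverse (hl Q) (hl Qᴴ) (fun V => by simp [← Matrix.mul_assoc, hQ1])
      (fun V => by simp [← Matrix.mul_assoc, hQ2]) ?_
    filter_upwards [H.ae_mem] with V hV
    exact hV.imp fun U hU => hU.imp fun s hs => hs.mul_unitary hQ
  -- Invariance under `R` for `h Qᴴ` is invariance under the conjugate `Qᴴ R Q` for `h`.
  · have hc' : Commute (Qᴴ * R * Q) (hᴴ * h) := by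
      have e : Q * (hᴴ * h) * Qᴴ = (h * Qᴴ)ᴴ * (h * Qᴴ) := by
        simp [Matrix.mul_assoc]
      rw [← e] at hc
      calc Qᴴ * R * Q * (hᴴ * h) = Qᴴ * (R * (Q * (hᴴ * h) * Qᴴ)) * Q := by
            simp only [Matrix.mul_assoc]; rw [hQ1, Matrix.mul_one]
        _ = Qᴴ * ((Q * (hᴴ * h) * Qᴴ) * R) * Q := by rw [hc.eq]
        _ = hᴴ * h * (Qᴴ * R * Q) := by
            simp only [← Matrix.mul_assoc]; rw [hQ1, Matrix.one_mul]
    have hR' : Qᴴ * R * Q ∈ unitaryGroup (Fin a) ℂ :=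
      mul_mem (mul_mem (Unitary.star_mem hQ) hR) hQ
    conv_rhs => rw [← H.map_mul_left _ hR' hc', Measure.map_map (hl _) (hl _)]
    rw [Measure.map_map (hl _) (hl _)]
    refine congrArg (fun f => Measure.map f ν) (funext fun V => ?_)
    simp only [Function.comp_apply, ← Matrix.mul_assoc]; rw [hQ2, Matrix.one_mul]

end IsUniformOnRightSingularFactors

/-! ### Unitary invariance of the Gaussian law -/

/-- The entries of a matrix as a vector of the real Hilbert space `ℂ ^ (b a)`. The codomain is an
`ℓ²` product rather than a matrix space because characteristic functions need the real
inner product `⟪A, B⟫ = Re tr (Aᴴ B)`. -/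
def flatten {b a : ℕ} (A : Matrix (Fin b) (Fin a) ℂ) : PiLp 2 fun _ : Fin b × Fin a => ℂ :=
  WithLp.toLp 2 fun p => A p.1 p.2

theorem measurable_flatten {b a : ℕ} : Measurable (flatten (b := b) (a := a)) :=
  (WithLp.measurable_toLp 2 _).comp <| measurable_pi_lambda _ fun p =>
    (measurable_pi_apply p.2).comp (measurable_pi_apply p.1)

/-- The real inner product of flattened matrices is `Re tr (Aᴴ B)`, so the adjoint of right
multiplication by `Qᴴ` is right multiplication by `Q`. -/
theorem inner_flatten {b a : ℕ} (A B : Matrix (Fin b) (Fin a) ℂ) :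
    inner ℝ (flatten A) (flatten B) = (Aᴴ * B).trace.re := by
  simp only [PiLp.inner_apply, flatten, Complex.inner, Matrix.trace, Matrix.diag, Matrix.mul_apply,
    conjTranspose_apply, Complex.re_sum]
  rw [Fintype.sum_prod_type, Finset.sum_comm]
  exact Finset.sum_congr rfl fun j _ => Finset.sum_congr rfl fun i _ => by rw [mul_comm]; rfl

namespace IsIIDComplexGaussian
variable {Ω : Type*} [MeasurableSpace Ω] {μ : Measure Ω} {b a : ℕ}
  {H : Ω → Matrix (Fin b) (Fin a) ℂ}

theorem measurable_entry (hH : IsIIDComplexGaussian H μ) (i : Fin b) (j : Fin a) :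
    Measurable fun ω => H ω i j :=
  (measurable_pi_apply j).comp ((measurable_pi_apply i).comp hH.measurable)

/-- Each entry is circularly symmetric: its characteristic function depends on `‖z‖` only. -/
theorem charFun_entry [IsProbabilityMeasure μ] (hH : IsIIDComplexGaussian H μ) (i : Fin b)
    (j : Fin a) (z : ℂ) :
    charFun (μ.map fun ω => H ω i j) z = Complex.exp (-(‖z‖ ^ 2 / 4 : ℝ)) := by
  have hm := hH.measurable_entry i j
  have hre : Measurable fun ω => (H ω i j).re := Complex.measurable_re.comp hm
  have him : Measurable fun ω => (H ω i j).im := Complex.measurable_im.comp hm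
  have hind : IndepFun (fun ω => z.re * (H ω i j).re) (fun ω => z.im * (H ω i j).im) μ :=
    (hH.indep_re_im i j).comp (measurable_const_mul z.re) (measurable_const_mul z.im)
  have hcf := congrFun (hind.charFun_map_fun_add_eq_mul (hre.const_mul _).aemeasurable
    (him.const_mul _).aemeasurable) 1
  -- `⟪H i j, z⟫ = Re z * Re (H i j) + Im z * Im (H i j)`, a sum of two independent real Gaussians.
  have e : charFun (μ.map fun ω => H ω i j) z =
      charFun (μ.map fun ω => z.re * (H ω i j).re + z.im * (H ω i j).im) 1 := by
    rw [charFun_apply, charFun_apply, integral_map hm.aemeasurable (by fun_prop),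
      integral_map (by fun_prop) (by fun_prop)]
    refine integral_congr_ae (.of_forall fun ω => ?_)
    simp [Complex.inner]
  rw [e, hcf, Pi.mul_apply]
  have h1 := (hH.law_re i j).map_eq
  have h2 := (hH.law_im i j).map_eq
  have h3 : ∀ (c : ℝ) (X : Ω → ℝ), Measurable X → μ.map X = gaussianReal 0 (1 / 2) →
      charFun (μ.map fun ω => c * X ω) 1 = Complex.exp (-(c ^ 2 / 4 : ℝ)) := by
    intro c X hX hl
    have : (fun ω => c * X ω) = (fun x => c * x) ∘ X := rfl
    rw [this, ← Measure.map_map (measurable_const_mul c) hX, hl, gaussianReal_map_const_mul,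
      charFun_gaussianReal]
    congr 1
    simp
    ring
  rw [h3 _ _ hre h1, h3 _ _ him h2, ← Complex.exp_add, Complex.sq_norm, Complex.normSq_apply]
  congr 1
  push_cast
  ring

/-- The characteristic function of the whole matrix is radial, because the entries are independent
and each of them contributes a Gaussian factor of the same variance. -/
theorem charFun_flatten [IsProbabilityMeasure μ] (hH : IsIIDComplexGaussian H μ)
    (t : PiLp 2 fun _ : Fin b × Fin a => ℂ) :
    charFun (μ.map fun ω => flatten (H ω)) t =
      Complex.exp (-(‖t‖ ^ 2 / 4 : ℝ)) := by
  have hm : ∀ p : Fin b × Fin a, Measurable fun ω => H ω p.1 p.2 :=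
    fun p => hH.measurable_entry p.1 p.2
  have hlaw := (iIndepFun.hasLaw_pi (μ := fun p : Fin b × Fin a => μ.map fun ω => H ω p.1 p.2)
    (fun p => ⟨(hm p).aemeasurable, rfl⟩) hH.iIndep_entries).map_eq
  have : ∀ p : Fin b × Fin a, IsProbabilityMeasure (μ.map fun ω => H ω p.1 p.2) :=
    fun p => Measure.isProbabilityMeasure_map (hm p).aemeasurable
  have e : (μ.map fun ω => flatten (H ω)) =
      (Measure.pi fun p : Fin b × Fin a => μ.map fun ω => H ω p.1 p.2).map (WithLp.toLp 2) := by
    rw [← hlaw, Measure.map_map (by fun_prop) (measurable_pi_lambda _ hm)]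
    rfl
  rw [e, charFun_pi]
  simp_rw [hH.charFun_entry]
  rw [← Complex.exp_sum, PiLp.norm_sq_eq_of_L2, Finset.sum_div]
  push_cast
  rw [Finset.sum_neg_distrib]

/-- The law of `H` is invariant under right multiplication by a unitary matrix: this map is a linear
isometry of the flattened matrices, and the characteristic function is radial. -/
theorem map_mul_unitary [IsProbabilityMeasure μ] (hH : IsIIDComplexGaussian H μ)
    {Q : Matrix (Fin a) (Fin a) ℂ} (hQ : Q ∈ unitaryGroup (Fin a) ℂ) :
    (μ.map fun ω => H ω * Qᴴ) = μ.map H := by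
  have hHQ : Measurable fun ω => H ω * Qᴴ :=
    measurable_pi_lambda _ fun i => measurable_pi_lambda _ fun j => by
      simp only [Matrix.mul_apply]
      exact Finset.measurable_sum _ fun k _ => (hH.measurable_entry i k).mul_const _
  have hfHQ : Measurable fun ω => flatten (H ω * Qᴴ) := measurable_flatten.comp hHQ
  have hfH : Measurable fun ω => flatten (H ω) := measurable_flatten.comp hH.measurable
  have hunit : Q * Qᴴ = 1 := mem_unitaryGroup_iff.1 hQ
  have hflat : (μ.map fun ω => flatten (H ω * Qᴴ)) = μ.map fun ω => flatten (H ω) := by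
    have : IsProbabilityMeasure (μ.map fun ω => flatten (H ω * Qᴴ)) :=
      Measure.isProbabilityMeasure_map hfHQ.aemeasurable
    have : IsProbabilityMeasure (μ.map fun ω => flatten (H ω)) :=
      Measure.isProbabilityMeasure_map hfH.aemeasurable
    refine Measure.ext_of_charFun (funext fun t => ?_)
    obtain ⟨T, rfl⟩ : ∃ T : Matrix (Fin b) (Fin a) ℂ, flatten T = t :=
      ⟨Matrix.of fun i j => t (i, j), rfl⟩
    have hinner : ∀ A : Matrix (Fin b) (Fin a) ℂ,
        inner ℝ (flatten (A * Qᴴ)) (flatten T) = inner ℝ (flatten A) (flatten (T * Q)) := by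
      intro A
      rw [inner_flatten, inner_flatten, conjTranspose_mul, conjTranspose_conjTranspose,
        Matrix.mul_assoc, trace_mul_comm, Matrix.mul_assoc]
    have hnorm : ‖flatten (T * Q)‖ ^ 2 = ‖flatten T‖ ^ 2 := by
      rw [← real_inner_self_eq_norm_sq, ← hinner, Matrix.mul_assoc, hunit, Matrix.mul_one,
        real_inner_self_eq_norm_sq]
    rw [hH.charFun_flatten, ← hnorm, ← hH.charFun_flatten, charFun_apply, charFun_apply,
      integral_map hfHQ.aemeasurable (by fun_prop),
      integral_map hfH.aemeasurable (by fun_prop)]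
    simp only [hinner]
  have hinv : Measurable fun x : PiLp 2 (fun _ : Fin b × Fin a => ℂ) =>
      (Matrix.of fun i j => x (i, j) : Matrix (Fin b) (Fin a) ℂ) :=
    measurable_pi_lambda _ fun i => measurable_pi_lambda _ fun j =>
      (measurable_pi_apply (i, j)).comp (WithLp.measurable_ofLp 2 _)
  have h := congrArg (Measure.map fun x : PiLp 2 (fun _ : Fin b × Fin a => ℂ) =>
      (Matrix.of fun i j => x (i, j) : Matrix (Fin b) (Fin a) ℂ)) hflat
  rwa [Measure.map_map hinv hfHQ, Measure.map_map hinv hfH] at h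

end IsIIDComplexGaussian

/-! ### Invariance of the joint law of right factor and singular values -/

section
variable {Ω : Type*} [MeasurableSpace Ω] {μ : Measure Ω} [IsProbabilityMeasure μ] {b a : ℕ}
  {H : Ω → Matrix (Fin b) (Fin a) ℂ} {V : Ω → Matrix (Fin a) (Fin a) ℂ}

/-- `(H Qᴴ, Q V)` has the law of `(H, V)`: the marginal law of `H` is invariant under `h ↦ h Qᴴ`, and
the conditional law of `V` is carried along because it is the uniform one. -/
theorem map_prodMk_mul_unitary (hH : IsIIDComplexGaussian H μ) (hV : Measurable V)
    (hVunif : ∀ᵐ h ∂(μ.map H), IsUniformOnRightSingularFactors h (condDistrib V H μ h))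
    {Q : Matrix (Fin a) (Fin a) ℂ} (hQ : Q ∈ unitaryGroup (Fin a) ℂ) :
    (μ.map fun ω => (H ω * Qᴴ, Q * V ω)) = μ.map fun ω => (H ω, V ω) := by
  have hR := measurable_matrix_mul_right (m := Fin b) Qᴴ
  have hL := measurable_matrix_mul_left (n := Fin a) Q
  have hHm := hH.measurable
  have hmap : (μ.map H).map (fun h => h * Qᴴ) = μ.map H := by
    rw [Measure.map_map hR hHm]; exact hH.map_mul_unitary hQ
  have : IsProbabilityMeasure (μ.map H) := Measure.isProbabilityMeasure_map hHm.aemeasurable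
  have hker : ∀ᵐ h ∂(μ.map H),
      condDistrib V H μ (h * Qᴴ) = (condDistrib V H μ h).map fun v => Q * v := by
    have h1 : ∀ᵐ h ∂(μ.map H),
        IsUniformOnRightSingularFactors (h * Qᴴ) (condDistrib V H μ (h * Qᴴ)) :=
      ae_of_ae_map hR.aemeasurable (by rwa [hmap])
    filter_upwards [hVunif, h1] with h h2 h3 using h3.unique (h2.mul_unitary hQ)
  have hpair : Measurable fun p : Matrix (Fin b) (Fin a) ℂ × Matrix (Fin a) (Fin a) ℂ =>
      (p.1 * Qᴴ, Q * p.2) := (hR.comp measurable_fst).prodMk (hL.comp measurable_snd)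
  have hcomp : (fun ω => (H ω * Qᴴ, Q * V ω)) = (fun p : _ × _ => (p.1 * Qᴴ, Q * p.2)) ∘
    fun ω => (H ω, V ω) := rfl
  rw [hcomp, ← Measure.map_map hpair (hHm.prodMk hV), ← compProd_map_condDistrib hV.aemeasurable]
  ext C hC
  rw [Measure.map_apply hpair hC, Measure.compProd_apply (hpair hC), Measure.compProd_apply hC]
  conv_rhs => rw [← hmap]
  rw [lintegral_map (Kernel.measurable_kernel_prodMk_left hC) hR]
  refine lintegral_congr_ae (hker.mono fun h hh => ?_)
  simp only [hh]
  rw [Measure.map_apply hL (measurable_prodMk_left hC)]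
  rfl

/-- The map `(h, v) ↦ (v, s)` that recovers the singular values `s l = √((vᴴ hᴴ h v) l l)` of `h`
from a right singular factor `v` of `h`. The values are read off from both `h` and `v`, and not from
`h` alone, because then the map is visibly measurable. -/
noncomputable def rightFactorSingularValues {b a : ℕ}
    (p : Matrix (Fin b) (Fin a) ℂ × Matrix (Fin a) (Fin a) ℂ) :
    Matrix (Fin a) (Fin a) ℂ × (Fin a → ℝ) :=
  (p.2, fun l => √((p.2ᴴ * (p.1ᴴ * p.1) * p.2) l l).re)

theorem measurable_rightFactorSingularValues {b a : ℕ} :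
    Measurable (rightFactorSingularValues (b := b) (a := a)) := by
  have h : Measurable fun p : Matrix (Fin b) (Fin a) ℂ × Matrix (Fin a) (Fin a) ℂ =>
      p.2ᴴ * (p.1ᴴ * p.1) * p.2 :=
    (measurable_snd.matrix_conjTranspose.matrix_mul
      (measurable_fst.matrix_conjTranspose.matrix_mul measurable_fst)).matrix_mul measurable_snd
  exact measurable_snd.prodMk <| measurable_pi_lambda _ fun l =>
    (Complex.measurable_re.comp ((measurable_pi_apply l).comp ((measurable_pi_apply l).comp h))).sqrt

theorem prodMk_singularValues_eq {Ω : Type*} {b a : ℕ} {H : Ω → Matrix (Fin b) (Fin a) ℂ}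
    {V : Ω → Matrix (Fin a) (Fin a) ℂ} {U : Ω → Matrix (Fin b) (Fin b) ℂ} {lam : Ω → Fin a → ℝ}
    (hSVD : ∀ ω, IsSVD (H ω) (U ω) (lam ω) (V ω)) :
    (fun ω => (V ω, lam ω)) = rightFactorSingularValues ∘ fun ω => (H ω, V ω) :=
  funext fun ω => Prod.ext rfl (funext fun l => (hSVD ω).singularValue_eq_sqrt l)

theorem measurable_singularValues (hH : Measurable H) (hV : Measurable V)
    {U : Ω → Matrix (Fin b) (Fin b) ℂ} {lam : Ω → Fin a → ℝ}
    (hSVD : ∀ ω, IsSVD (H ω) (U ω) (lam ω) (V ω)) : Measurable lam := by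
  have h : Measurable fun ω => (V ω, lam ω) := by
    rw [prodMk_singularValues_eq hSVD]
    exact measurable_rightFactorSingularValues.comp (hH.prodMk hV)
  exact h.snd

/-- The passage from `(H, V)` to `(H Qᴴ, Q V)` does not change the singular values. -/
theorem map_mul_left_prodMk_singularValues (hH : IsIIDComplexGaussian H μ) (hV : Measurable V)
    (hVunif : ∀ᵐ h ∂(μ.map H), IsUniformOnRightSingularFactors h (condDistrib V H μ h))
    {U : Ω → Matrix (Fin b) (Fin b) ℂ} {lam : Ω → Fin a → ℝ}
    (hSVD : ∀ ω, IsSVD (H ω) (U ω) (lam ω) (V ω))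
    {Q : Matrix (Fin a) (Fin a) ℂ} (hQ : Q ∈ unitaryGroup (Fin a) ℂ) :
    (μ.map fun ω => (Q * V ω, lam ω)) = μ.map fun ω => (V ω, lam ω) := by
  have hR := measurable_matrix_mul_right (m := Fin b) Qᴴ
  have hL := measurable_matrix_mul_left (n := Fin a) Q
  have hHV : Measurable fun ω => (H ω * Qᴴ, Q * V ω) :=
    (hR.comp hH.measurable).prodMk (hL.comp hV)
  rw [prodMk_singularValues_eq hSVD, prodMk_singularValues_eq fun ω => (hSVD ω).mul_unitary hQ,
    ← Measure.map_map measurable_rightFactorSingularValues (hH.measurable.prodMk hV),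
    ← Measure.map_map measurable_rightFactorSingularValues hHV,
    map_prodMk_mul_unitary hH hV hVunif hQ]

/-- Left invariance of the law of `V`, jointly with `X`, implies right invariance: on each event
`X ∈ A` the laws of `V` and of `V R` are left-invariant and have the same mass, so they agree. -/
theorem map_mul_right_prodMk_of_map_mul_left_prodMk {β : Type*} [MeasurableSpace β] {X : Ω → β}
    (hX : Measurable X) (hV : Measurable V) (hVu : ∀ ω, V ω ∈ unitaryGroup (Fin a) ℂ)
    (hinv : ∀ Q ∈ unitaryGroup (Fin a) ℂ,
      (μ.map fun ω => (Q * V ω, X ω)) = μ.map fun ω => (V ω, X ω))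
    {R : Matrix (Fin a) (Fin a) ℂ} (hR : R ∈ unitaryGroup (Fin a) ℂ) :
    (μ.map fun ω => (V ω * R, X ω)) = μ.map fun ω => (V ω, X ω) := by
  have hL := measurable_matrix_mul_left (m := Fin a) (n := Fin a)
  have hRm := measurable_matrix_mul_right (m := Fin a) R
  have hVR : Measurable fun ω => V ω * R := hRm.comp hV
  have : IsProbabilityMeasure (μ.map fun ω => (V ω * R, X ω)) :=
    Measure.isProbabilityMeasure_map (hVR.prodMk hX).aemeasurable
  refine Measure.ext_prod fun {C A} hC hA => ?_
  have hprod : ∀ {Y : Ω → Matrix (Fin a) (Fin a) ℂ}, Measurable Y →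
      ∀ {D : Set (Matrix (Fin a) (Fin a) ℂ)}, MeasurableSet D →
      (μ.map fun ω => (Y ω, X ω)) (D ×ˢ A) = ((μ.restrict (X ⁻¹' A)).map Y) D := by
    intro Y hY D hD
    rw [Measure.map_apply (hY.prodMk hX) (hD.prod hA), Measure.map_apply hY hD,
      Measure.restrict_apply (hY hD)]
    rfl
  rw [hprod hVR hC, hprod hV hC]
  have hleft : ∀ Q ∈ unitaryGroup (Fin a) ℂ, ((μ.restrict (X ⁻¹' A)).map V).map (fun v => Q * v) =
      (μ.restrict (X ⁻¹' A)).map V := by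
    intro Q hQ
    ext D hD
    rw [Measure.map_map (hL Q) hV, ← hprod hV hD, ← hinv Q hQ]
    exact (hprod ((hL Q).comp hV) hD).symm
  have hcomp : (μ.restrict (X ⁻¹' A)).map (fun ω => V ω * R) =
      ((μ.restrict (X ⁻¹' A)).map V).map fun v => v * R := (Measure.map_map hRm hV).symm
  have hmem : ∀ {Y : Ω → Matrix (Fin a) (Fin a) ℂ}, Measurable Y →
      (∀ ω, Y ω ∈ unitaryGroup (Fin a) ℂ) →
      ∀ᵐ v ∂((μ.restrict (X ⁻¹' A)).map Y), v ∈ (unitaryGroup (Fin a) ℂ : Set _) := by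
    intro Y hY hYu
    have hc : MeasurableSet {v : Matrix (Fin a) (Fin a) ℂ | v ∈ unitaryGroup (Fin a) ℂ} := by
      simp only [mem_unitaryGroup_iff]
      exact measurableSet_eq_fun
        (measurable_id.matrix_mul measurable_id.matrix_conjTranspose) measurable_const
    exact (ae_map_iff hY.aemeasurable hc).2 (.of_forall hYu)
  refine congrArg (fun ρ : Measure _ => ρ C) (measure_eq_of_map_mul_left
    (S := (unitaryGroup (Fin a) ℂ : Set _)) (fun Q hQ => Unitary.star_mem hQ) ?_
    (hmem hVR fun ω => mul_mem (hVu ω) hR) (hmem hV hVu) (fun Q hQ => ?_) hleft)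
  · rw [Measure.map_apply hVR .univ, Measure.map_apply hV .univ]; rfl
  · conv_rhs => rw [hcomp, ← hleft Q hQ, Measure.map_map hRm (hL Q)]
    rw [hcomp, Measure.map_map (hL Q) hRm]
    simp only [Function.comp_def, Matrix.mul_assoc]

end

/-! ### Conditional uniformity of the permutation -/

section
variable {Ω : Type*} [MeasurableSpace Ω] {μ : Measure Ω} {a : ℕ}
  {P : Ω → Matrix (Fin a) (Fin a) ℂ}

theorem permMatrix_mem_unitaryGroup (σ : Equiv.Perm (Fin a)) :
    σ.permMatrix ℂ ∈ unitaryGroup (Fin a) ℂ := by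
  rw [mem_unitaryGroup_iff, star_eq_conjTranspose, conjTranspose_permMatrix, ← permMatrix_mul,
    inv_mul_cancel, permMatrix_one]

theorem permMatrix_injective :
    Function.Injective fun σ : Equiv.Perm (Fin a) => σ.permMatrix ℂ := by
  intro σ τ h
  ext i
  -- Apply both matrices to the vector `(0, 1, 2, …)`.
  have := congrArg (fun M : Matrix (Fin a) (Fin a) ℂ => M *ᵥ fun j => ((j : ℕ) : ℂ)) h
  simp only [permMatrix_mulVec] at this
  simpa using congrFun this i

theorem IsUniformPermMatrix.ae_exists_eq [IsProbabilityMeasure μ] (hP : IsUniformPermMatrix P μ) :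
    ∀ᵐ ω ∂μ, ∃ σ : Equiv.Perm (Fin a), P ω = σ.permMatrix ℂ := by
  have hm : ∀ σ : Equiv.Perm (Fin a), MeasurableSet {ω | P ω = σ.permMatrix ℂ} :=
    fun σ => hP.measurable (measurableSet_singleton _)
  have hU : MeasurableSet (⋃ σ : Equiv.Perm (Fin a), {ω | P ω = σ.permMatrix ℂ}) :=
    .iUnion hm
  have h1 : μ (⋃ σ : Equiv.Perm (Fin a), {ω | P ω = σ.permMatrix ℂ}) = 1 := by
    rw [measure_iUnion (fun σ τ hne => Set.disjoint_left.2 fun ω h h' =>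
      hne (permMatrix_injective (h.symm.trans h'))) hm]
    simp only [hP.prob_eq, tsum_fintype, Finset.sum_const, Finset.card_univ, Fintype.card_perm,
      Fintype.card_fin, nsmul_eq_mul]
    exact ENNReal.mul_inv_cancel (by exact_mod_cast a.factorial_ne_zero) (ENNReal.natCast_ne_top _)
  filter_upwards [(prob_compl_eq_zero_iff hU).2 h1] with ω hω
  simpa using hω

/-- On the event `P = σ` one has `V P = V σ`, whose joint law with `X` is that of `(V, X)`; independence
of `P` then leaves a probability that does not depend on `σ`. -/
theorem IsUniformPermMatrix.measure_inter_preimage {β : Type*} [MeasurableSpace β]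
    (hP : IsUniformPermMatrix P μ)
    {V : Ω → Matrix (Fin a) (Fin a) ℂ} {X : Ω → β} (hV : Measurable V) (hX : Measurable X)
    (hind : IndepFun P (fun ω => (V ω, X ω)) μ)
    (hinv : ∀ σ : Equiv.Perm (Fin a),
      (μ.map fun ω => (V ω * σ.permMatrix ℂ, X ω)) = μ.map fun ω => (V ω, X ω))
    (σ : Equiv.Perm (Fin a)) {B : Set (Matrix (Fin a) (Fin a) ℂ × β)} (hB : MeasurableSet B) :
    μ ({ω | P ω = σ.permMatrix ℂ} ∩ (fun ω => (V ω * P ω, X ω)) ⁻¹' B) =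
      ((a ! : ℕ) : ℝ≥0∞)⁻¹ * μ ((fun ω => (V ω, X ω)) ⁻¹' B) := by
  have hs : Measurable fun p : Matrix (Fin a) (Fin a) ℂ × β => (p.1 * σ.permMatrix ℂ, p.2) :=
    ((measurable_matrix_mul_right _).comp measurable_fst).prodMk measurable_snd
  have e : {ω | P ω = σ.permMatrix ℂ} ∩ (fun ω => (V ω * P ω, X ω)) ⁻¹' B =
      P ⁻¹' {σ.permMatrix ℂ} ∩ (fun ω => (V ω, X ω)) ⁻¹'
        ((fun p : Matrix (Fin a) (Fin a) ℂ × β => (p.1 * σ.permMatrix ℂ, p.2)) ⁻¹' B) := by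
    ext ω
    simp only [Set.mem_inter_iff, Set.mem_ofPred_eq, Set.mem_preimage, Set.mem_singleton_iff]
    exact and_congr_right fun h => by rw [h]
  rw [e, hind.measure_inter_preimage_eq_mul _ _ (measurableSet_singleton _) (hs hB)]
  congr 1
  · exact hP.prob_eq σ
  · have hσ : Measurable fun ω => (V ω * σ.permMatrix ℂ, X ω) := hs.comp (hV.prodMk hX)
    rw [← Measure.map_apply (hV.prodMk hX) hB, ← hinv σ, Measure.map_apply hσ hB]
    rfl

/-- Right invariance of the law of `V`, jointly with `X`, hides the permutation: `P` is uniform given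
`(V P, X)`. -/
theorem IsUniformPermMatrix.condExp_eq {β : Type*} [MeasurableSpace β]
    [IsProbabilityMeasure μ] (hP : IsUniformPermMatrix P μ)
    {V : Ω → Matrix (Fin a) (Fin a) ℂ} {X : Ω → β} (hV : Measurable V) (hX : Measurable X)
    (hind : IndepFun P (fun ω => (V ω, X ω)) μ)
    (hinv : ∀ σ : Equiv.Perm (Fin a),
      (μ.map fun ω => (V ω * σ.permMatrix ℂ, X ω)) = μ.map fun ω => (V ω, X ω))
    (σ : Equiv.Perm (Fin a)) :
    μ⟦{ω | P ω = σ.permMatrix ℂ} |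
        MeasurableSpace.comap (fun ω => (V ω * P ω, X ω)) inferInstance⟧
      =ᵐ[μ] fun _ => 1 / ((a ! : ℕ) : ℝ) := by
  have hW : Measurable fun ω => (V ω * P ω, X ω) := (hV.matrix_mul hP.measurable).prodMk hX
  have hm : ∀ σ : Equiv.Perm (Fin a), MeasurableSet {ω | P ω = σ.permMatrix ℂ} :=
    fun σ => hP.measurable (measurableSet_singleton _)
  -- Summing over the values of `P`, `(V P, X)` has the law of `(V, X)`.
  have hWV : ∀ {B : Set (Matrix (Fin a) (Fin a) ℂ × β)}, MeasurableSet B →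
      μ ((fun ω => (V ω * P ω, X ω)) ⁻¹' B) = μ ((fun ω => (V ω, X ω)) ⁻¹' B) := by
    intro B hB
    have hc : μ ((fun ω => (V ω * P ω, X ω)) ⁻¹' B) = μ (⋃ σ : Equiv.Perm (Fin a),
        {ω | P ω = σ.permMatrix ℂ} ∩ (fun ω => (V ω * P ω, X ω)) ⁻¹' B) := by
      refine measure_congr ?_
      filter_upwards [hP.ae_exists_eq] with ω hω
      refine propext ⟨fun h => ?_, fun h => ?_⟩
      · obtain ⟨σ, hσ⟩ := hω
        exact Set.mem_iUnion.2 ⟨σ, hσ, h⟩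
      · obtain ⟨σ, -, h⟩ := Set.mem_iUnion.1 h
        exact h
    rw [hc, measure_iUnion (fun σ τ hne => Set.disjoint_left.2 fun ω h h' =>
      hne (permMatrix_injective (h.1.symm.trans h'.1))) fun σ => (hm σ).inter (hW hB)]
    simp only [hP.measure_inter_preimage hV hX hind hinv _ hB, tsum_fintype, Finset.sum_const,
      Finset.card_univ, Fintype.card_perm, Fintype.card_fin, nsmul_eq_mul]
    rw [← mul_assoc, ENNReal.mul_inv_cancel (by exact_mod_cast a.factorial_ne_zero)
      (ENNReal.natCast_ne_top _), one_mul]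
  refine (ae_eq_condExp_of_forall_setIntegral_eq hW.comap_le
    ((integrable_const (1 : ℝ)).indicator (hm σ))
    (fun _ _ _ => integrableOn_const (measure_ne_top _ _)) ?_
    stronglyMeasurable_const.aestronglyMeasurable).symm
  rintro _ ⟨B, hB, rfl⟩ -
  rw [setIntegral_const, setIntegral_indicator (hm σ), setIntegral_const, Set.inter_comm,
    measureReal_def, measureReal_def, hP.measure_inter_preimage hV hX hind hinv σ hB, hWV hB,
    ENNReal.toReal_mul, ENNReal.toReal_inv, ENNReal.toReal_natCast]
  simp [mul_comm]

/-- The permutation induced by `Mᵀ` is `π` exactly when `M` is the matrix of `π⁻¹`, since transposing a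
permutation matrix inverts the permutation. -/
theorem forall_transpose_mulVec_eq_comp_iff {M : Matrix (Fin a) (Fin a) ℂ}
    {π : Equiv.Perm (Fin a)} :
    (∀ x : Fin a → ℂ, Mᵀ *ᵥ x = x ∘ π) ↔ M = (π⁻¹).permMatrix ℂ := by
  rw [← transpose_permMatrix, ← transpose_inj, transpose_transpose,
    ← Matrix.mulVec_injective.eq_iff, funext_iff]
  simp only [permMatrix_mulVec]

end

theorem lemma1 {Ω : Type*} [MeasurableSpace Ω] (μ : Measure Ω) [IsProbabilityMeasure μ]
    (N nB : ℕ)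
    (H : Ω → Matrix (Fin nB) (Fin (2 * N)) ℂ) (hH : IsIIDComplexGaussian H μ)
    -- a singular value decomposition of `H`, with zero-padded singular values `lam`
    (U : Ω → Matrix (Fin nB) (Fin nB) ℂ) (lam : Ω → Fin (2 * N) → ℝ)
    (V : Ω → Matrix (Fin (2 * N)) (Fin (2 * N)) ℂ)
    (hSVD : ∀ ω, IsSVD (H ω) (U ω) (lam ω) (V ω))
    -- among the possible right factors, `V` is picked uniformly
    (hV : Measurable V)
    (hVunif : ∀ᵐ h ∂(μ.map H), IsUniformOnRightSingularFactors h (condDistrib V H μ h))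
    -- the uniformly random permutation matrix, chosen independently of the channel
    (P : Ω → Matrix (Fin (2 * N)) (Fin (2 * N)) ℂ) (hP : IsUniformPermMatrix P μ)
    (hPindep : IndepFun P (fun ω => (H ω, V ω)) μ)
    -- the precoding matrix revealed to Alice
    (W : Ω → Matrix (Fin (2 * N)) (Fin (2 * N)) ℂ) (hW : ∀ ω, W ω = V ω * P ω) :
    Measurable (fun ω => (W ω, lam ω)) ∧
    (∀ σ σ' : Equiv.Perm (Fin (2 * N)),
      μ⟦{ω | P ω = σ.permMatrix ℂ} | MeasurableSpace.comap (fun ω => (W ω, lam ω)) inferInstance⟧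
        =ᵐ[μ]
      μ⟦{ω | P ω = σ'.permMatrix ℂ} | MeasurableSpace.comap (fun ω => (W ω, lam ω)) inferInstance⟧) ∧
    (∀ σ : Equiv.Perm (Fin (2 * N)),
      μ⟦{ω | P ω = σ.permMatrix ℂ} | MeasurableSpace.comap (fun ω => (W ω, lam ω)) inferInstance⟧
        =ᵐ[μ] fun _ => 1 / ((2 * N)! : ℝ)) ∧
    -- the permutation `π` with `Pᵀ x = (x_{π(0)}, x_{π(1)}, …)`, which tells which
    -- subchannel carries which gain, is conditionally uniform as well
    (∀ π : Equiv.Perm (Fin (2 * N)),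
      μ⟦{ω | ∀ x : Fin (2 * N) → ℂ, (P ω)ᵀ *ᵥ x = x ∘ π} |
          MeasurableSpace.comap (fun ω => (W ω, lam ω)) inferInstance⟧
        =ᵐ[μ] fun _ => 1 / ((2 * N)! : ℝ)) := by
  have hlam : Measurable lam := measurable_singularValues hH.measurable hV hSVD
  obtain rfl : W = fun ω => V ω * P ω := funext hW
  have hind : IndepFun P (fun ω => (V ω, lam ω)) μ := by
    rw [prodMk_singularValues_eq hSVD]
    exact hPindep.comp measurable_id measurable_rightFactorSingularValues
  have hcond := hP.condExp_eq hV hlam hind fun σ =>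
    map_mul_right_prodMk_of_map_mul_left_prodMk hlam hV (fun ω => (hSVD ω).right_unitary)
      (fun Q hQ => map_mul_left_prodMk_singularValues hH hV hVunif hSVD hQ)
      (permMatrix_mem_unitaryGroup σ)
  refine ⟨(hV.matrix_mul hP.measurable).prodMk hlam, fun σ σ' => (hcond σ).trans (hcond σ').symm,
    hcond, fun π => ?_⟩
  simp only [forall_transpose_mulVec_eq_comp_iff]
  exact hcond π⁻¹
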